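/- Let $A\in\mathbb R^{n\times n}$, $B\in\mathbb R^{n\times m}$, $C\in\mathbb R^{p\times n}$ and let $N$ agents obey $x_i(t+1)=Ax_i(t)+Bu_i(t)$, $y_i(t)=Cx_i(t)$, $t=0,1,\dots$ Let $[a_{ij}]$ be the weight matrix of a directed graph on the agents: $a_{ij}\ge 0$, $a_{ii}=0$, and $j\in N_i$ (agent $i$ receives from agent $j$) if and only if $a_{ij}>0$. Let $\mathcal L=\mathrm{diag}(\sum_j a_{1j},\dots,\sum_j a_{Nj})-[a_{ij}]$ be the Laplacian, with eigenvalues (counted with algebraic multiplicity) $\lambda_1(\mathcal L)=0,\lambda_2(\mathcal L),\dots,\lambda_N(\mathcal L)$. For $0<a\le 1$ and an integer $M\ge1$ let $Q_{a,M}(y)=ia$ if $ia-\frac a2\le y<ia+\frac a2$, $i=0,\dots,M-1$; $Q_{a,M}(y)=Ma$ if $y\ge Ma-\frac a2$; and $Q_{a,M}(y)=-Q_{a,M}(-y)$ if $y<-\frac a2$; apply $Q_{a,M}$ to vectors componentwise. A communication protocol is given by parameters $\gamma\in(0,1)$, $\alpha,\alpha_u\in(0,1]$, integers $L,L_u\ge1$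 and $G\in\mathbb R^{n\times p}$. Every agent $j$ runs the encoder, for $t\ge1$, $$s_j(t)=Q_{\alpha,L}\Big(\tfrac{y_j(t-1)-C\hat x_j(t-1)}{\gamma^{t-1}}\Big),\quad \hat x_j(t)=A\hat x_j(t-1)+\gamma^{t-1}Gs_j(t)+B\hat u_j(t-1),$$ $$s_{u,j}(t)=Q_{\alpha_u,L_u}\Big(\tfrac{u_j(t)-\hat u_j(t-1)}{\gamma^{t-1}}\Big),\quad \hat u_j(t)=\hat u_j(t-1)+\gamma^{t-1}s_{u,j}(t),$$ and every receiver $i$ of $j$ runs the decoder $$\hat x_{ji}(t)=A\hat x_{ji}(t-1)+\gamma^{t-1}Gs_j(t)+B\hat u_{ji}(t-1),\quad \hat u_{ji}(t)=\hat u_{ji}(t-1)+\gamma^{t-1}s_{u,j}(t),$$ with $\hat x_{ji}(0)=\hat x_j(0)$, $\hat u_{ji}(0)=\hat u_j(0)$. The control protocol with gain $K\in\mathbb R^{m\times n}$ is $u_i(t)=K\sum_{j\in N_i}a_{ij}(\hat x_{ji}(t)-\hat x_i(t))$. The quantization errors are $$\Delta_j(t)=\tfrac{y_j(t)-C\hat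 x_j(t)}{\gamma^{t}}-s_j(t+1),\qquad \Delta_{u,j}(t)=\tfrac{u_j(t+1)-\hat u_j(t)}{\gamma^{t}}-s_{u,j}(t+1),\qquad t\ge0.$$ **Theorem.** Suppose that there is $K\in\mathbb R^{m\times n}$ such that all eigenvalues of $A-\lambda_i(\mathcal L)BK$, $i=2,\dots,N$, lie in the open unit disk, and that $(A,C)$ is detectable, i.e. there is $G\in\mathbb R^{n\times p}$ such that all eigenvalues of $A-GC$ lie in the open unit disk. Then there are constants $W,W_u>0$ such that for all $C_x,C_{\hat x},C_{\hat u}>0$ there are a communication protocol $(\gamma,\alpha,\alpha_u,L,L_u,G)$ and a gain $K$ as above such that, for all initial values with $\max_i\|x_i(0)\|_\infty<C_x$, $\max_i\|\hat x_i(0)\|_\infty<C_{\hat x}$, $\max_i\|\hat u_i(0)\|_\infty<C_{\hat u}$: 1. (inter-agent state observation) $x_j(t)-\hat x_j(t)\to0$ for all $j$, and $x_j(t)-\hat x_{ji}(t)\to0$ for all $i$ and all $j\in N_i$, as $t\to\infty$; 2. (cooperative stabilization) $x_i(t)-x_j(t)\to0$ for all $i,j$, and $\delta_i(t)=x_i(t)-\frac{1}{\sum_j\pi_j}\sum_j\pi_jx_j(t)\to0$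 for all $i$ and every nonzero $\pi\in\mathbb R^N$ with nonnegative entries and $\pi^T\mathcal L=0$; 3. $\|\Delta_j(t)\|_\infty\le W$ and $\|\Delta_{u,j}(t)\|_\infty\le W_u$ for all $t\ge0$ and all $j$; 4. the quantizers never saturate: for all $t\ge0$ and all $j$, $\big\|\frac{y_j(t)-C\hat x_j(t)}{\gamma^t}\big\|_\infty<\alpha L+\frac\alpha2$ and $\big\|\frac{u_j(t+1)-\hat u_j(t)}{\gamma^t}\big\|_\infty<\alpha_uL_u+\frac{\alpha_u}2$. -/

import Mathlib

open Filter Topology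
open scoped Matrix

noncomputable section

namespace QuantizedNetwork

/-- A dynamic network `(A, B, C, 𝒢)`: `N` identical agents `x⁺ = A x + B u`, `y = C x`, and a weighted
directed graph on the agents with weight matrix `adj`; agent `i` receives from agent `j` exactly when
`adj i j > 0`. -/
structure DynamicNetwork (N n m p : ℕ) where
  A : Matrix (Fin n) (Fin n) ℝ
  B : Matrix (Fin n) (Fin m) ℝ
  C : Matrix (Fin p) (Fin n) ℝ
  adj : Matrix (Fin N) (Fin N) ℝ
  adj_nonneg : ∀ i j, 0 ≤ adj i j
  adj_diag : ∀ i, adj i i = 0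

/-- All complex eigenvalues lie in the open unit disk. -/
def IsSchur {n : ℕ} (M : Matrix (Fin n) (Fin n) ℂ) : Prop :=
  ∀ z ∈ spectrum ℂ M, ‖z‖ < 1

/-- A real matrix regarded as a complex one. -/
def toC {k l : ℕ} (M : Matrix (Fin k) (Fin l) ℝ) : Matrix (Fin k) (Fin l) ℂ :=
  M.map (algebraMap ℝ ℂ)

namespace DynamicNetwork

variable {N n m p : ℕ}

/-- The set `N_i` of agents from which agent `i` receives. -/
def neighbors (D : DynamicNetwork N n m p) (i : Fin N) : Finset (Fin N) :=
  Finset.univ.filter (fun j => 0 < D.adj i j)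

/-- The Laplacian: in-degree matrix minus weight matrix. -/
def laplacian (D : DynamicNetwork N n m p) : Matrix (Fin N) (Fin N) ℝ :=
  Matrix.diagonal (fun i => ∑ j, D.adj i j) - D.adj

/-- The eigenvalues `λ₂, …, λ_N` of the Laplacian: all complex eigenvalues, counted with algebraic
multiplicity, with one copy of `λ₁ = 0` removed. -/
def otherEigenvalues (D : DynamicNetwork N n m p) : Multiset ℂ :=
  (toC D.laplacian).charpoly.roots.erase 0

/-- One real gain `K` makes all `A - λ_i B K`, `i = 2, …, N`, Schur stable. -/
def SimultaneouslyStabilizable (D : DynamicNetwork N n m p) : Prop :=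
  ∃ K : Matrix (Fin m) (Fin n) ℝ, ∀ z ∈ D.otherEigenvalues,
    IsSchur (toC D.A - z • toC (D.B * K))

/-- `(A, C)` is detectable: some output injection `G` makes `A - G C` Schur stable. -/
def Detectable (D : DynamicNetwork N n m p) : Prop :=
  ∃ G : Matrix (Fin n) (Fin p) ℝ, IsSchur (toC (D.A - G * D.C))

end DynamicNetwork

/-- The finite-level uniform quantizer on inputs `y ≥ -a/2`: the value is `i a` for
`i a - a/2 ≤ y < i a + a/2`, `i = 0, …, M - 1` (so that `i = ⌊y / a + 1/2⌋`), and `M a` for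
`y ≥ M a - a/2`. -/
def quantizePos (a : ℝ) (M : ℕ) (y : ℝ) : ℝ :=
  if (M : ℝ) * a - a / 2 ≤ y then (M : ℝ) * a else (⌊y / a + 1 / 2⌋ : ℝ) * a

/-- The finite-level uniform quantizer with step `a` and `2 M + 1` levels, extended by
`Q(y) = -Q(-y)` to `y < -a/2`. -/
def quantize (a : ℝ) (M : ℕ) (y : ℝ) : ℝ :=
  if y < -(a / 2) then -quantizePos a M (-y) else quantizePos a M y

/-- The quantizer acts on vectors componentwise. -/
def quantizeVec {k : ℕ} (a : ℝ) (M : ℕ) (v : Fin k → ℝ) : Fin k → ℝ :=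
  fun l => quantize a M (v l)

/-- The parameters `(γ, α, α_u, L, L_u, G)` of a communication protocol. -/
structure CommProtocol (n p : ℕ) where
  γ : ℝ
  α : ℝ
  αu : ℝ
  L : ℕ
  Lu : ℕ
  G : Matrix (Fin n) (Fin p) ℝ
  γ_pos : 0 < γ
  γ_lt_one : γ < 1
  α_pos : 0 < α
  α_le_one : α ≤ 1
  αu_pos : 0 < αu
  αu_le_one : αu ≤ 1
  one_le_L : 1 ≤ L
  one_le_Lu : 1 ≤ Lu

/-- The state of the whole closed loop at one time: agent states `x j`, encoder states `xhat j`,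
`uhat j`, and the states `xdec i j`, `udec i j` of the decoder that agent `i` runs for agent `j`. -/
structure NetState (N n m : ℕ) where
  x : Fin N → Fin n → ℝ
  xhat : Fin N → Fin n → ℝ
  uhat : Fin N → Fin m → ℝ
  xdec : Fin N → Fin N → Fin n → ℝ
  udec : Fin N → Fin N → Fin m → ℝ

section ClosedLoop

variable {N n m p : ℕ} (D : DynamicNetwork N n m p) (P : CommProtocol n p)
  (K : Matrix (Fin m) (Fin n) ℝ)

/-- The control law `u_i = K ∑_{j ∈ N_i} a_{ij} (x̂_{ji} - x̂_i)`. -/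
def control (xdec : Fin N → Fin N → Fin n → ℝ) (xhat : Fin N → Fin n → ℝ) (i : Fin N) :
    Fin m → ℝ :=
  K *ᵥ ∑ j ∈ D.neighbors i, D.adj i j • (xdec i j - xhat i)

/-- The input `(y_j(t) - C x̂_j(t)) / γ^t` of the innovation quantizer of agent `j`. -/
def innovation (t : ℕ) (σ : NetState N n m) (j : Fin N) : Fin p → ℝ :=
  (P.γ ^ t)⁻¹ • (D.C *ᵥ σ.x j - D.C *ᵥ σ.xhat j)

/-- The transmitted symbol `s_j(t + 1)`. -/
def symbol (t : ℕ) (σ : NetState N n m) (j : Fin N) : Fin p → ℝ :=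
  quantizeVec P.α P.L (innovation D P t σ j)

/-- Encoder update: `x̂_j(t + 1)`. -/
def nextXhat (t : ℕ) (σ : NetState N n m) (j : Fin N) : Fin n → ℝ :=
  D.A *ᵥ σ.xhat j + P.γ ^ t • (P.G *ᵥ symbol D P t σ j) + D.B *ᵥ σ.uhat j

/-- Decoder update: `x̂_{ji}(t + 1)`. -/
def nextXdec (t : ℕ) (σ : NetState N n m) (i j : Fin N) : Fin n → ℝ :=
  D.A *ᵥ σ.xdec i j + P.γ ^ t • (P.G *ᵥ symbol D P t σ j) + D.B *ᵥ σ.udec i j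

/-- The input `(u_j(t + 1) - û_j(t)) / γ^t` of the control quantizer of agent `j`; the control input
`u_j(t + 1)` is computed from the updated estimates. -/
def ctrlInnovation (t : ℕ) (σ : NetState N n m) (j : Fin N) : Fin m → ℝ :=
  (P.γ ^ t)⁻¹ • (control D K (nextXdec D P t σ) (nextXhat D P t σ) j - σ.uhat j)

/-- The transmitted symbol `s_{u,j}(t + 1)`. -/
def ctrlSymbol (t : ℕ) (σ : NetState N n m) (j : Fin N) : Fin m → ℝ :=
  quantizeVec P.αu P.Lu (ctrlInnovation D P K t σ j)

/-- One step of the closed loop, from time `t` to time `t + 1`. -/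
def step (t : ℕ) (σ : NetState N n m) : NetState N n m where
  x i := D.A *ᵥ σ.x i + D.B *ᵥ control D K σ.xdec σ.xhat i
  xhat := nextXhat D P t σ
  uhat j := σ.uhat j + P.γ ^ t • ctrlSymbol D P K t σ j
  xdec := nextXdec D P t σ
  udec i j := σ.udec i j + P.γ ^ t • ctrlSymbol D P K t σ j

/-- The closed-loop trajectory from `x_i(0) = x0 i`, `x̂_i(0) = x̂_{ij}(0) = xhat0 i`,
`û_i(0) = û_{ij}(0) = uhat0 i`. -/
def closedLoop (x0 xhat0 : Fin N → Fin n → ℝ) (uhat0 : Fin N → Fin m → ℝ) : ℕ → NetState N n m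
  | 0 => ⟨x0, xhat0, uhat0, fun _ j => xhat0 j, fun _ j => uhat0 j⟩
  | t + 1 => step D P K t (closedLoop x0 xhat0 uhat0 t)

/-- The quantization error `Δ_j(t)` of the innovation quantizer. -/
def innovationError (t : ℕ) (σ : NetState N n m) (j : Fin N) : Fin p → ℝ :=
  innovation D P t σ j - symbol D P t σ j

/-- The quantization error `Δ_{u,j}(t)` of the control quantizer. -/
def ctrlError (t : ℕ) (σ : NetState N n m) (j : Fin N) : Fin m → ℝ :=
  ctrlInnovation D P K t σ j - ctrlSymbol D P K t σ j

/-- Inter-agent state observation: every state estimation error tends to `0`, both at the encoders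
(`E_j = x_j - x̂_j`) and at the decoders of all channels (`x_j - x̂_{ji}`, `j ∈ N_i`). -/
def AchievesObservation (σ : ℕ → NetState N n m) : Prop :=
  (∀ j, Tendsto (fun t => (σ t).x j - (σ t).xhat j) atTop (𝓝 0)) ∧
  ∀ i, ∀ j ∈ D.neighbors i, Tendsto (fun t => (σ t).x j - (σ t).xdec i j) atTop (𝓝 0)

/-- The cooperative stabilization error `δ_i = x_i - (∑_j π_j)⁻¹ ∑_j π_j x_j`. -/
def stabilizationError (w : Fin N → ℝ) (σ : NetState N n m) (i : Fin N) : Fin n → ℝ :=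
  σ.x i - (∑ j, w j)⁻¹ • ∑ j, w j • σ.x j

/-- Cooperative stabilization: all differences `x_i - x_j` tend to `0`, and so does `δ`, for every
nonzero nonnegative left eigenvector of the Laplacian for the eigenvalue `0`. -/
def AchievesStabilization (σ : ℕ → NetState N n m) : Prop :=
  (∀ i j, Tendsto (fun t => (σ t).x i - (σ t).x j) atTop (𝓝 0)) ∧
  ∀ w : Fin N → ℝ, (∀ i, 0 ≤ w i) → w ≠ 0 → w ᵥ* D.laplacian = 0 →
    Tendsto (fun t => stabilizationError w (σ t)) atTop (𝓝 0)

end ClosedLoop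

end QuantizedNetwork

end

open QuantizedNetwork

/-! Put E_j = x_j - x̂_j and H_j = u_j - û_j. Decoders copy their encoders, so the quantized loop is
a cascade: H(t+1) = γ^t Δ_u(t); E_j is driven through A - GC by γ^t G Δ_j and B H_j; x follows the
exact-exchange consensus dynamics perturbed linearly by E (`inputError_step`,
`estimationError_step`, `x_step`).

Detectability makes A - GC stable. Differences with agent 0 evolve under A ⊗ 1 - BK ⊗ L', with L'
the reduced Laplacian, whose eigenvalues are λ_2, …, λ_N; so this matrix is stable too. By Gelfand's
formula each stable stage contracts an adapted seminorm in one step. For γ above both rates,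
unsaturated quantizers keep H, E and the disagreement below constants times γ^t.

These bounds in turn keep the scaled quantizer inputs bounded. An unsaturated error is at most half
a step whatever the number of levels, so the levels can be chosen last and induction on t closes the
argument (`Certificate.Holds.step`). -/

/-! ### Stable matrices and adapted seminorms -/

section Gelfand
attribute [local instance] Matrix.linftyOpNormedRing Matrix.linftyOpNormedAlgebra
  Matrix.linftyOpNormedAddCommGroup Matrix.linftyOpNormedSpace

open scoped NNReal ENNReal in
/-- A power of an element of a complex Banach algebra whose spectrum lies in the open unit disk is
a strict contraction, at a geometric rate. -/
theorem exists_norm_pow_le_of_spectrum_subset_ball {𝔸 : Type*} [NormedRing 𝔸] [NormedAlgebra ℂ 𝔸]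
    [CompleteSpace 𝔸] (a : 𝔸) (h : ∀ z ∈ spectrum ℂ a, ‖z‖ < 1) :
    ∃ r : ℝ, 0 < r ∧ r < 1 ∧ ∃ k : ℕ, 0 < k ∧ ‖a ^ k‖ ≤ r ^ k := by
  have hρ : spectralRadius ℂ a < 1 := by
    rcases subsingleton_or_nontrivial 𝔸 with _ | _
    · rw [spectrum.SpectralRadius.of_subsingleton]; exact one_pos
    · exact_mod_cast spectrum.spectralRadius_lt_of_forall_lt a (r := 1) fun z hz => h z hz
  obtain ⟨r, hr, hr1⟩ := ENNReal.lt_iff_exists_nnreal_btwn.1 hρ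
  have hr1 : r < 1 := by exact_mod_cast hr1
  have hr0 : 0 < r := by
    have := (zero_le (a := spectralRadius ℂ a)).trans_lt hr
    exact_mod_cast this
  obtain ⟨k, hk, hk0⟩ :=
    (((spectrum.pow_nnnorm_pow_one_div_tendsto_nhds_spectralRadius a).eventually_lt_const
    hr).and (eventually_gt_atTop 0)).exists
  refine ⟨r, hr0, hr1, k, hk0, ?_⟩
  have hk' : (k : ℝ) ≠ 0 := by positivity
  have h2 : (‖a ^ k‖₊ : ℝ≥0∞) ≤ (r : ℝ≥0∞) ^ k := by
    have := ENNReal.rpow_le_rpow hk.le (z := k) (by positivity)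
    rwa [← ENNReal.rpow_mul, one_div_mul_cancel hk', ENNReal.rpow_one, ENNReal.rpow_natCast] at this
  have h3 : ‖a ^ k‖₊ ≤ r ^ k := by exact_mod_cast h2
  exact_mod_cast h3

/-- The powers of a real square matrix all of whose complex eigenvalues lie in the open unit disk
eventually contract the maximum norm at a geometric rate. -/
theorem Matrix.exists_norm_pow_mulVec_le {ι : Type*} [Fintype ι] [DecidableEq ι] (M : Matrix ι ι ℝ)
    (h : ∀ z ∈ spectrum ℂ (M.map (algebraMap ℝ ℂ)), ‖z‖ < 1) :
    ∃ r : ℝ, 0 < r ∧ r < 1 ∧ ∃ k : ℕ, 0 < k ∧ ∀ v : ι → ℝ, ‖(M ^ k) *ᵥ v‖ ≤ r ^ k * ‖v‖ := by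
  obtain ⟨r, hr0, hr1, k, hk, hle⟩ := exists_norm_pow_le_of_spectrum_subset_ball _ h
  refine ⟨r, hr0, hr1, k, hk, fun v => ?_⟩
  have hn (w : ι → ℝ) : ‖algebraMap ℝ ℂ ∘ w‖ = ‖w‖ := by
    simp [Pi.norm_def]
  have hm : algebraMap ℝ ℂ ∘ ((M ^ k) *ᵥ v) = (M.map (algebraMap ℝ ℂ)) ^ k *ᵥ (algebraMap ℝ ℂ ∘ v) := by
    rw [← Matrix.map_pow]
    ext i
    exact RingHom.map_mulVec (algebraMap ℝ ℂ) _ _ _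
  rw [← hn, hm, ← hn v]
  exact (Matrix.linfty_opNorm_mulVec _ _).trans (by gcongr)

end Gelfand

/-- A continuous linear map a power of which contracts at the geometric rate `r` contracts, at the
same rate in one step, a seminorm equivalent to the norm. -/
theorem ContinuousLinearMap.exists_seminorm_le_mul {E : Type*} [SeminormedAddCommGroup E]
    [NormedSpace ℝ E] (T : E →L[ℝ] E) {r : ℝ} (hr : 0 < r) {k : ℕ} (hk : 0 < k)
    (h : ∀ v, ‖(T ^ k) v‖ ≤ r ^ k * ‖v‖) :
    ∃ V : Seminorm ℝ E, (∀ v, ‖v‖ ≤ V v) ∧ (∃ c, 0 ≤ c ∧ ∀ v, V v ≤ c * ‖v‖) ∧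
      ∀ v, V (T v) ≤ r * V v := by
  -- Applying `T` shifts this sum: up to the factor `r`, the term ‖v‖ is traded for the term of
  -- index `k`, which `h` bounds by ‖v‖.
  obtain ⟨V, hV⟩ : ∃ V : Seminorm ℝ E, ∀ v, V v = ∑ i ∈ Finset.range k, (r ^ i)⁻¹ * ‖(T ^ i) v‖ := by
    refine ⟨Seminorm.of (fun v => ∑ i ∈ Finset.range k, (r ^ i)⁻¹ * ‖(T ^ i) v‖) (fun v w => ?_)
      (fun a v => ?_), fun _ => rfl⟩
    · rw [← Finset.sum_add_distrib]
      refine Finset.sum_le_sum fun i _ => ?_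
      rw [← mul_add, map_add]
      gcongr
      exact norm_add_le _ _
    · rw [Finset.mul_sum]
      refine Finset.sum_congr rfl fun i _ => ?_
      rw [map_smul, norm_smul]
      ring
  refine ⟨V, fun v => ?_, ⟨∑ i ∈ Finset.range k, (r ^ i)⁻¹ * ‖T ^ i‖, by positivity, fun v => ?_⟩,
    fun v => ?_⟩
  · rw [hV]
    calc ‖v‖ = (r ^ 0)⁻¹ * ‖(T ^ 0) v‖ := by simp
      _ ≤ _ := Finset.single_le_sum (f := fun i => (r ^ i)⁻¹ * ‖(T ^ i) v‖)
        (fun i _ => by positivity) (Finset.mem_range.2 hk)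
  · rw [hV, Finset.sum_mul]
    refine Finset.sum_le_sum fun i _ => ?_
    rw [mul_assoc]
    gcongr
    exact (T ^ i).le_opNorm v
  · rw [hV, hV]
    have hstep (i : ℕ) : (r ^ i)⁻¹ * ‖(T ^ i) (T v)‖ = r * ((r ^ (i + 1))⁻¹ * ‖(T ^ (i + 1)) v‖) := by
      rw [show (T ^ (i + 1)) v = (T ^ i) (T v) by rw [pow_succ]; rfl, pow_succ r]
      field_simp
    simp_rw [hstep, ← Finset.mul_sum]
    refine mul_le_mul_of_nonneg_left ?_ hr.le
    have h1 := Finset.sum_range_succ (fun i => (r ^ i)⁻¹ * ‖(T ^ i) v‖) k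
    rw [Finset.sum_range_succ'] at h1
    have h2 : (r ^ k)⁻¹ * ‖(T ^ k) v‖ ≤ (r ^ 0)⁻¹ * ‖(T ^ 0) v‖ := by
      rw [inv_mul_le_iff₀ (by positivity)]
      simpa using h v
    linarith

/-- A linear map between finite-dimensional normed spaces is bounded. -/
theorem LinearMap.exists_norm_le_mul {E F : Type*} [NormedAddCommGroup E] [NormedSpace ℝ E]
    [FiniteDimensional ℝ E] [NormedAddCommGroup F] [NormedSpace ℝ F] (f : E →ₗ[ℝ] F) :
    ∃ c, 0 ≤ c ∧ ∀ v, ‖f v‖ ≤ c * ‖v‖ :=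
  ⟨‖f.toContinuousLinearMap‖, norm_nonneg _, f.toContinuousLinearMap.le_opNorm⟩

/-! ### Eigenvalues of Kronecker combinations -/

theorem Matrix.mem_spectrum_of_mulVec_eq {ι : Type*} [Fintype ι] [DecidableEq ι]
    {M : Matrix ι ι ℂ} {z : ℂ} {v : ι → ℂ} (hv : v ≠ 0) (h : M *ᵥ v = z • v) :
    z ∈ spectrum ℂ M := by
  rw [← Matrix.spectrum_toLin', ← Module.End.hasEigenvalue_iff_mem_spectrum]
  exact Module.End.hasEigenvalue_of_hasEigenvector (x := v)
    ⟨Module.End.mem_eigenspace_iff.2 (by simpa using h), hv⟩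

open scoped Kronecker in
/-- Every eigenvalue of `A ⊗ 1 - S ⊗ Λ` is an eigenvalue of `A - z S` for an eigenvalue `z`
of `Λ`. -/
theorem Matrix.exists_mem_spectrum_of_mem_spectrum_kronecker {ι κ : Type*} [Fintype ι]
    [DecidableEq ι] [Fintype κ] [DecidableEq κ] (A S : Matrix ι ι ℂ) (Λ : Matrix κ κ ℂ) {μ : ℂ}
    (hμ : μ ∈ spectrum ℂ (A ⊗ₖ (1 : Matrix κ κ ℂ) - S ⊗ₖ Λ)) :
    ∃ z ∈ spectrum ℂ Λ, μ ∈ spectrum ℂ (A - z • S) := by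
  set T := A ⊗ₖ (1 : Matrix κ κ ℂ) - S ⊗ₖ Λ with hT
  set C := (1 : Matrix ι ι ℂ) ⊗ₖ Λ with hC
  -- Commuting gives `T` and 1 ⊗ Λ a common eigenvector. Read as a matrix, its nonzero columns are
  -- eigenvectors of `Λ` and its nonzero rows are eigenvectors of `A - z • S`.
  have hcomm : T * C = C * T := by
    simp [hT, hC, sub_mul, mul_sub, ← Matrix.mul_kronecker_mul]
  rw [← Matrix.spectrum_toLin', ← Module.End.hasEigenvalue_iff_mem_spectrum] at hμ
  let F := Module.End.eigenspace (Matrix.toLin' T) μ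
  have hmem (v) : v ∈ F ↔ T *ᵥ v = μ • v := by simp [F]
  have hinv : ∀ v ∈ F, Matrix.toLin' C v ∈ F := by
    intro v hv
    rw [hmem] at hv ⊢
    rw [Matrix.toLin'_apply, Matrix.mulVec_mulVec, hcomm, ← Matrix.mulVec_mulVec, hv,
      Matrix.mulVec_smul]
  have : Nontrivial F := Submodule.nontrivial_iff_ne_bot.2 hμ
  obtain ⟨z, hz⟩ := Module.End.exists_eigenvalue ((Matrix.toLin' C).restrict hinv)
  obtain ⟨⟨v, hvF⟩, hv⟩ := hz.exists_hasEigenvector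
  have hv0 : v ≠ 0 := fun h => hv.2 (by simp [h])
  have hCv : C *ᵥ v = z • v := by
    have := congrArg Subtype.val hv.apply_eq_smul
    simpa using this
  rw [hmem] at hvF
  obtain ⟨X, rfl⟩ : ∃ X : Matrix κ ι ℂ, X.vec = v := ⟨Matrix.of fun j i => v (i, j), rfl⟩
  have hΛX : Λ * X = z • X := by
    rw [hC, Matrix.kronecker_mulVec_vec, ← Matrix.vec_smul, Matrix.vec_inj] at hCv
    simpa using hCv
  have hX : X * (A - z • S)ᵀ = μ • X := by
    rw [hT, Matrix.sub_mulVec, Matrix.kronecker_mulVec_vec, Matrix.kronecker_mulVec_vec,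
      ← Matrix.vec_smul, ← Matrix.vec_sub, Matrix.vec_inj, hΛX] at hvF
    rw [← hvF]
    simp [Matrix.mul_sub]
  obtain ⟨j, i, hji⟩ : ∃ j i, X j i ≠ 0 := by
    by_contra! h
    exact hv0 (by rw [show X = 0 from Matrix.ext h]; simp)
  refine ⟨z, Matrix.mem_spectrum_of_mulVec_eq (v := fun j => X j i) (fun h => hji (congrFun h j)) ?_,
    Matrix.mem_spectrum_of_mulVec_eq (v := X j) (fun h => hji (congrFun h i)) ?_⟩
  · ext j'
    exact congrFun (congrFun hΛX j') i
  · rw [← Matrix.vecMul_transpose]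
    exact congrFun hX j

/-! ### The reduced Laplacian and the disagreement dynamics -/

namespace QuantizedNetwork
open Polynomial

namespace DynamicNetwork
variable {N n m p : ℕ}

theorem sum_laplacian_row (D : DynamicNetwork N n m p) (i : Fin N) : ∑ j, D.laplacian i j = 0 := by
  simp [laplacian, Matrix.diagonal_apply]

theorem sum_laplacian_smul (D : DynamicNetwork N n m p) (X : Fin N → Fin n → ℝ) (i : Fin N) :
    ∑ j, D.laplacian i j • X j = -∑ j, D.adj i j • (X j - X i) := by
  simp [laplacian, Matrix.diagonal_apply, sub_smul, smul_sub, Finset.sum_smul]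

/-- The map induced by the Laplacian on differences with agent `0`. -/
def reducedLaplacian (D : DynamicNetwork (N + 1) n m p) : Matrix (Fin N) (Fin N) ℝ :=
  Matrix.of fun i j => D.laplacian i.succ j.succ - D.laplacian 0 j.succ

/-- Zero row sums factor the Laplacian as `M * R`, with `R` taking differences with agent 0. The
reduced Laplacian is `R * M`, and swapping the factors changes the characteristic polynomial only by
a power of X. -/
theorem charpoly_laplacian (D : DynamicNetwork (N + 1) n m p) :
    D.laplacian.charpoly = X * D.reducedLaplacian.charpoly := by
  let M : Matrix (Fin (N + 1)) (Fin N) ℝ := D.laplacian.submatrix id Fin.succ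
  let R : Matrix (Fin N) (Fin (N + 1)) ℝ := Matrix.of fun i j =>
    (if i.succ = j then 1 else 0) - (if 0 = j then 1 else 0)
  have h1 : D.laplacian = M * R := by
    ext i j
    refine Fin.cases ?_ (fun j => ?_) j
    · have := D.sum_laplacian_row i
      rw [Fin.sum_univ_succ] at this
      simp only [Matrix.mul_apply, Matrix.submatrix_apply, Matrix.of_apply, id, M, R]
      simp only [Fin.succ_ne_zero, if_false, if_true, zero_sub, mul_neg, mul_one,
        Finset.sum_neg_distrib]
      linarith
    · simp [Matrix.mul_apply, M, R, (Fin.succ_ne_zero _).symm]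
  have h2 : D.reducedLaplacian = R * M := by
    ext i j
    simp [Matrix.mul_apply, M, R, reducedLaplacian, sub_mul]
  rw [h1, Matrix.charpoly_mul_comm_of_le _ _ (by simp), h2]
  simp

/-- The factor X accounts for exactly the erased copy of 0, so the multiplicities match even if 0 is
a multiple eigenvalue. -/
theorem mem_otherEigenvalues_of_mem_spectrum (D : DynamicNetwork (N + 1) n m p) {z : ℂ}
    (hz : z ∈ spectrum ℂ (toC D.reducedLaplacian)) : z ∈ D.otherEigenvalues := by
  rw [Matrix.mem_spectrum_iff_isRoot_charpoly] at hz
  have h : (toC D.laplacian).charpoly = X * (toC D.reducedLaplacian).charpoly := by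
    rw [toC, toC, Matrix.charpoly_map, Matrix.charpoly_map, charpoly_laplacian]
    simp
  have h0 : (toC D.reducedLaplacian).charpoly ≠ 0 := (Matrix.charpoly_monic _).ne_zero
  rw [otherEigenvalues, h, roots_mul (mul_ne_zero X_ne_zero h0), roots_X, Multiset.singleton_add,
    Multiset.erase_cons_head]
  exact (mem_roots h0).2 hz

/-- The inputs `K ∑ j, a i j • Y i j` computed from relative states `Y i j`. -/
def relInput (D : DynamicNetwork N n m p) (K : Matrix (Fin m) (Fin n) ℝ) :
    (Fin N → Fin N → Fin n → ℝ) →ₗ[ℝ] (Fin N → Fin m → ℝ) where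
  toFun Y i := K *ᵥ ∑ j, D.adj i j • Y i j
  map_add' Y Z := by
    ext1 i
    simp [smul_add, Finset.sum_add_distrib, Matrix.mulVec_add]
  map_smul' a Y := by
    ext1 i
    simp only [Pi.smul_apply, RingHom.id_apply, smul_comm _ a, ← Finset.smul_sum,
      Matrix.mulVec_smul]

/-- The relative states `X j - X i`. -/
def relState (N n : ℕ) : (Fin N → Fin n → ℝ) →ₗ[ℝ] (Fin N → Fin N → Fin n → ℝ) where
  toFun X i j := X j - X i
  map_add' X Y := by
    ext1 i; ext1 j
    simp only [Pi.add_apply]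
    abel
  map_smul' a X := by
    ext1 i; ext1 j
    simp [smul_sub]

theorem control_eq_relInput (D : DynamicNetwork N n m p) (K : Matrix (Fin m) (Fin n) ℝ)
    (xdec : Fin N → Fin N → Fin n → ℝ) (xhat : Fin N → Fin n → ℝ) :
    control D K xdec xhat = D.relInput K (fun i j => xdec i j - xhat i) := by
  ext1 i
  simp only [control, relInput, LinearMap.coe_mk, AddHom.coe_mk]
  congr 1
  refine Finset.sum_subset (Finset.subset_univ _) fun j _ hj => ?_
  have : D.adj i j = 0 := by
    have := D.adj_nonneg i j
    simp only [neighbors, Finset.mem_filter, Finset.mem_univ, true_and, not_lt] at hj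
    exact le_antisymm hj this
  simp [this]

/-- The closed loop with exact state exchange. -/
def idealStep (D : DynamicNetwork N n m p) (K : Matrix (Fin m) (Fin n) ℝ)
    (X : Fin N → Fin n → ℝ) : Fin N → Fin n → ℝ :=
  fun i => D.A *ᵥ X i + D.B *ᵥ D.relInput K (relState N n X) i

end DynamicNetwork

/-- A Schur stable real matrix contracts a seminorm equivalent to the maximum norm. -/
theorem _root_.Matrix.exists_seminorm_mulVec_le {ι : Type*} [Fintype ι] [DecidableEq ι]
    (M : Matrix ι ι ℝ) (h : ∀ z ∈ spectrum ℂ (M.map (algebraMap ℝ ℂ)), ‖z‖ < 1) :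
    ∃ r : ℝ, 0 < r ∧ r < 1 ∧ ∃ V : Seminorm ℝ (ι → ℝ), (∀ v, ‖v‖ ≤ V v) ∧
      (∃ c, 0 ≤ c ∧ ∀ v, V v ≤ c * ‖v‖) ∧ ∀ v, V (M *ᵥ v) ≤ r * V v := by
  obtain ⟨r, hr0, hr1, k, hk, hle⟩ := M.exists_norm_pow_mulVec_le h
  have hpow (v) : ((Matrix.toLin' M).toContinuousLinearMap ^ k) v = M ^ k *ᵥ v := by
    rw [← Matrix.toLin'_apply, Matrix.toLin'_pow, Module.End.pow_apply]
    simp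
  obtain ⟨V, h1, h2, h3⟩ := (Matrix.toLin' M).toContinuousLinearMap.exists_seminorm_le_mul hr0 hk
    fun v => (by rw [hpow]; exact hle v)
  exact ⟨r, hr0, hr1, V, h1, h2, fun v => by simpa using h3 v⟩

namespace DynamicNetwork
variable {N n m p : ℕ}

/-- The differences with agent `0`. -/
def disagreement (N n : ℕ) : (Fin (N + 1) → Fin n → ℝ) →ₗ[ℝ] (Fin n × Fin N → ℝ) where
  toFun X := Matrix.vec (Matrix.of fun i => X (Fin.succ i) - X 0)
  map_add' X Y := by
    ext ⟨l, i⟩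
    simp only [Matrix.vec, Matrix.of_apply, Pi.add_apply, Pi.sub_apply]
    ring
  map_smul' a X := by
    ext ⟨l, i⟩
    simp only [Matrix.vec, Matrix.of_apply, Pi.smul_apply, Pi.sub_apply, smul_eq_mul,
      RingHom.id_apply]
    ring

theorem norm_sub_zero_le_disagreement (X : Fin (N + 1) → Fin n → ℝ) (i : Fin (N + 1)) :
    ‖X i - X 0‖ ≤ ‖disagreement N n X‖ := by
  refine (pi_norm_le_iff_of_nonneg (norm_nonneg _)).2 fun l => ?_
  refine Fin.cases (by simp) (fun i => ?_) i
  exact norm_le_pi_norm (disagreement N n X) (l, i)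

open scoped Kronecker in
theorem disagreement_idealStep (D : DynamicNetwork (N + 1) n m p) (K : Matrix (Fin m) (Fin n) ℝ)
    (X : Fin (N + 1) → Fin n → ℝ) :
    disagreement N n (D.idealStep K X) =
      (D.A ⊗ₖ (1 : Matrix (Fin N) (Fin N) ℝ) - (D.B * K) ⊗ₖ D.reducedLaplacian) *ᵥ
        disagreement N n X := by
  -- Zero row sums allow subtracting X 0 from every state, which removes the term of agent 0.
  have hu (i) : D.relInput K (relState _ n X) i =
      -(K *ᵥ ∑ j : Fin N, D.laplacian i j.succ • (X j.succ - X 0)) := by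
    have h : ∑ j, D.laplacian i j • (X j - X 0) = ∑ j, D.laplacian i j • X j := by
      simp only [smul_sub, Finset.sum_sub_distrib, ← Finset.sum_smul, D.sum_laplacian_row]
      simp
    rw [D.sum_laplacian_smul X, Fin.sum_univ_succ, sub_self, smul_zero, zero_add] at h
    rw [h, Matrix.mulVec_neg, neg_neg]
    rfl
  simp only [disagreement, LinearMap.coe_mk, AddHom.coe_mk]
  rw [Matrix.sub_mulVec, Matrix.kronecker_mulVec_vec, Matrix.kronecker_mulVec_vec,
      ← Matrix.vec_sub, Matrix.vec_inj]
  ext i l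
  have hr (Y : Matrix (Fin N) (Fin n) ℝ) : (D.reducedLaplacian * Y) i =
      ∑ j : Fin N, (D.laplacian i.succ j.succ - D.laplacian 0 j.succ) • Y j := by
    ext l
    simp [Matrix.mul_apply, reducedLaplacian]
  have hrow (Y : Matrix (Fin N) (Fin n) ℝ) (S : Matrix (Fin n) (Fin n) ℝ) :
      (Y * Sᵀ) i l = (S *ᵥ Y i) l := by
    simp [Matrix.mul_apply, Matrix.mulVec, dotProduct, mul_comm]
  have hof (k : Fin N) : Matrix.of (fun i : Fin N => X i.succ - X 0) k = X k.succ - X 0 := rfl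
  rw [Matrix.sub_apply, hrow, hrow, hr, Matrix.one_mul, ← Pi.sub_apply]
  refine congrFun ?_ l
  change D.idealStep K X i.succ - D.idealStep K X 0 = _
  simp only [idealStep, hu, hof, Matrix.mulVec_sub, Matrix.mulVec_neg, sub_smul,
    Finset.sum_sub_distrib, ← Matrix.mulVec_mulVec]
  abel

theorem exists_seminorm_idealStep_le (D : DynamicNetwork N n m p) (K : Matrix (Fin m) (Fin n) ℝ)
    (hK : ∀ z ∈ D.otherEigenvalues, IsSchur (toC D.A - z • toC (D.B * K))) :
    ∃ r : ℝ, 0 < r ∧ r < 1 ∧ ∃ V : Seminorm ℝ (Fin N → Fin n → ℝ), (∀ X i j, ‖X i - X j‖ ≤ V X) ∧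
      (∃ c, 0 ≤ c ∧ ∀ X, V X ≤ c * ‖X‖) ∧ ∀ X, V (D.idealStep K X) ≤ r * V X := by
  rcases N with _ | N
  · exact ⟨1 / 2, by norm_num, by norm_num, 0, fun _ i => i.elim0, ⟨0, le_rfl, by simp⟩, by simp⟩
  obtain ⟨r, hr0, hr1, V, h1, ⟨c, hc0, hc⟩, h3⟩ := Matrix.exists_seminorm_mulVec_le
    (.kronecker D.A (1 : Matrix (Fin N) (Fin N) ℝ) - .kronecker (D.B * K) D.reducedLaplacian) (by
      intro μ hμ
      obtain ⟨z, hz, hz'⟩ := Matrix.exists_mem_spectrum_of_mem_spectrum_kronecker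
        (toC D.A) (toC (D.B * K)) (toC D.reducedLaplacian) (μ := μ) (by
          convert hμ using 2
          ext i j
          simp [toC, Matrix.one_apply, apply_ite])
      exact hK z (D.mem_otherEigenvalues_of_mem_spectrum hz) μ hz')
  obtain ⟨d, hd0, hd⟩ := (disagreement N n).exists_norm_le_mul
  -- The factor 2 pays for comparing two agents through agent 0.
  have hV (X) : ((2 : NNReal) • V.comp (disagreement N n)) X = 2 * V (disagreement N n X) := rfl
  refine ⟨r, hr0, hr1, (2 : NNReal) • V.comp (disagreement N n), fun X i j => ?_,
    ⟨2 * (c * d), by positivity, fun X => ?_⟩, fun X => ?_⟩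
  · rw [hV, ← sub_sub_sub_cancel_right (X i) (X j) (X 0)]
    refine (norm_sub_le _ _).trans ?_
    have := h1 (disagreement N n X)
    linarith [norm_sub_zero_le_disagreement X i, norm_sub_zero_le_disagreement X j]
  · rw [hV, mul_assoc, mul_assoc]
    gcongr
    exact (hc _).trans (by gcongr; exact hd X)
  · rw [hV, hV, disagreement_idealStep, mul_left_comm]
    gcongr
    exact h3 _

end DynamicNetwork
end QuantizedNetwork

/-! ### Quantization errors -/

namespace QuantizedNetwork
open DynamicNetwork

/-- Outside the top branch the formula rounds to the nearest multiple of `a`, for `y` of any sign;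
the upper bound serves only the top branch. -/
theorem abs_sub_quantizePos_le {a : ℝ} (ha : 0 < a) (M : ℕ) {y : ℝ} (h2 : y < a * M + a / 2) :
    |y - quantizePos a M y| ≤ a / 2 := by
  unfold quantizePos
  split_ifs with h
  · rw [abs_le]
    constructor <;> linarith
  · have h3 := Int.floor_le (y / a + 1 / 2)
    have h4 := Int.lt_floor_add_one (y / a + 1 / 2)
    have h5 : y / a * a = y := div_mul_cancel₀ y ha.ne'
    have h6 := mul_le_mul_of_nonneg_right h3 ha.le
    have h7 := mul_lt_mul_of_pos_right h4 ha
    rw [abs_le]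
    constructor <;> linarith

/-- An unsaturated quantizer of step `a` makes an error of at most `a / 2`. -/
theorem abs_sub_quantize_le {a : ℝ} (ha : 0 < a) (M : ℕ) {y : ℝ} (h : |y| < a * M + a / 2) :
    |y - quantize a M y| ≤ a / 2 := by
  unfold quantize
  split_ifs with hy
  · rw [sub_neg_eq_add, ← abs_neg, neg_add']
    exact abs_sub_quantizePos_le ha M ((neg_le_abs y).trans_lt h)
  · exact abs_sub_quantizePos_le ha M ((le_abs_self y).trans_lt h)

theorem norm_sub_quantizeVec_le {k : ℕ} {a : ℝ} (ha : 0 < a) (M : ℕ) {v : Fin k → ℝ}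
    (h : ‖v‖ < a * M + a / 2) : ‖v - quantizeVec a M v‖ ≤ a / 2 :=
  (pi_norm_le_iff_of_nonneg (by positivity)).2 fun l =>
    abs_sub_quantize_le ha M ((norm_le_pi_norm v l).trans_lt h)

/-! ### Error dynamics of the closed loop -/

section ClosedLoop

variable {N n m p : ℕ} (D : DynamicNetwork N n m p) (P : CommProtocol n p)
  (K : Matrix (Fin m) (Fin n) ℝ)

/-- Every decoder reproduces the encoder that it follows. -/
structure NetState.Synchronized (σ : NetState N n m) : Prop where
  xdec_eq : ∀ i j, σ.xdec i j = σ.xhat j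
  udec_eq : ∀ i j, σ.udec i j = σ.uhat j

variable {D P K}

theorem NetState.Synchronized.step {σ : NetState N n m} (h : σ.Synchronized) (t : ℕ) :
    (step D P K t σ).Synchronized := by
  constructor <;> intro i j
  · simp [QuantizedNetwork.step, nextXdec, nextXhat, h.xdec_eq, h.udec_eq]
  · simp [QuantizedNetwork.step, h.udec_eq]

theorem NetState.Synchronized.control_eq {σ : NetState N n m} (h : σ.Synchronized) :
    control D K σ.xdec σ.xhat = D.relInput K (relState N n σ.xhat) := by
  rw [control_eq_relInput]
  simp only [h.xdec_eq]
  rfl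

/-- Multiplying the symbol by γ^t restores the output error up to γ^t Δ, so the encoder is a
Luenberger observer fed with û in place of u. -/
theorem estimationError_step (t : ℕ) {σ : NetState N n m} (h : σ.Synchronized) (j : Fin N) :
    (step D P K t σ).x j - (step D P K t σ).xhat j =
      (D.A - P.G * D.C) *ᵥ (σ.x j - σ.xhat j) + P.γ ^ t • (P.G *ᵥ innovationError D P t σ j) +
        D.B *ᵥ (D.relInput K (relState N n σ.xhat) - σ.uhat) j := by
  have hγ : P.γ ^ t ≠ 0 := (pow_pos P.γ_pos t).ne'
  simp only [step, nextXhat, h.control_eq, innovationError, innovation]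
  simp only [Matrix.mulVec_sub, Matrix.sub_mulVec, Matrix.mulVec_smul, smul_sub, Pi.sub_apply,
    smul_smul, mul_inv_cancel₀ hγ, one_smul, ← Matrix.mulVec_mulVec]
  abel

theorem x_step (t : ℕ) {σ : NetState N n m} (h : σ.Synchronized) :
    (step D P K t σ).x = D.idealStep K σ.x -
      fun i => D.B *ᵥ D.relInput K (relState N n (σ.x - σ.xhat)) i := by
  ext1 i
  simp only [step, idealStep, h.control_eq, map_sub, Pi.sub_apply, Matrix.mulVec_sub]
  abel

/-- The encoder adds the quantized increment to û, so only the newest quantization error survives.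
-/
theorem inputError_step (t : ℕ) {σ : NetState N n m} (h : σ.Synchronized) :
    D.relInput K (relState N n (step D P K t σ).xhat) - (step D P K t σ).uhat =
      P.γ ^ t • ctrlError D P K t σ := by
  have hγ : P.γ ^ t ≠ 0 := (pow_pos P.γ_pos t).ne'
  rw [← (h.step t).control_eq]
  ext1 j
  simp only [Pi.sub_apply, Pi.smul_apply, ctrlError, ctrlInnovation, smul_sub, smul_smul,
    mul_inv_cancel₀ hγ, one_smul, step]
  abel

theorem ctrlInnovation_eq (t : ℕ) {σ : NetState N n m} (h : σ.Synchronized) :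
    ctrlInnovation D P K t σ = (P.γ ^ t)⁻¹ •
      (D.relInput K (relState N n (step D P K t σ).xhat) - D.relInput K (relState N n σ.xhat) +
        (D.relInput K (relState N n σ.xhat) - σ.uhat)) := by
  rw [sub_add_sub_cancel, ← (h.step t).control_eq]
  rfl

/-! ### Invariant bounds decaying like γ^t -/

variable (D P K) in
/-- Seminorms contracted by the estimation error and by the disagreement of the agents, and bounds
at time `0` that the closed loop reproduces, scaled by `γ ^ t`, at every time `t`. -/
structure Certificate where
  VE : Seminorm ℝ (Fin n → ℝ)
  V : Seminorm ℝ (Fin N → Fin n → ℝ)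
  (rE r cE cV cB cC cG cR ME Mx MH : ℝ)
  rE_nonneg : 0 ≤ rE
  r_nonneg : 0 ≤ r
  cE_nonneg : 0 ≤ cE
  cV_nonneg : 0 ≤ cV
  cB_nonneg : 0 ≤ cB
  cC_nonneg : 0 ≤ cC
  cG_nonneg : 0 ≤ cG
  cR_nonneg : 0 ≤ cR
  ME_nonneg : 0 ≤ ME
  Mx_nonneg : 0 ≤ Mx
  norm_le_VE : ∀ v, ‖v‖ ≤ VE v
  VE_le : ∀ v, VE v ≤ cE * ‖v‖
  VE_contract : ∀ v, VE ((D.A - P.G * D.C) *ᵥ v) ≤ rE * VE v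
  norm_sub_le_V : ∀ X i j, ‖X i - X j‖ ≤ V X
  V_le : ∀ X, V X ≤ cV * ‖X‖
  V_contract : ∀ X, V (D.idealStep K X) ≤ r * V X
  B_le : ∀ v, ‖D.B *ᵥ v‖ ≤ cB * ‖v‖
  C_le : ∀ v, ‖D.C *ᵥ v‖ ≤ cC * ‖v‖
  G_le : ∀ v, ‖P.G *ᵥ v‖ ≤ cG * ‖v‖
  R_le : ∀ Y, ‖D.relInput K Y‖ ≤ cR * ‖Y‖
  -- The constraints are triangular: `MH` is free of the others, `ME` needs `MH`, `Mx` needs `ME`,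
  -- and the level counts come last.
  le_ME : rE * ME + cE * (cG * (P.α / 2) + cB * MH) ≤ ME * P.γ
  le_Mx : r * Mx + cV * (cB * (cR * (2 * ME))) ≤ Mx * P.γ
  le_MH : P.αu / 2 ≤ MH * P.γ
  lt_L : cC * ME < P.α * P.L + P.α / 2
  lt_Lu : 2 * (cR * (Mx + 2 * ME)) + MH < P.αu * P.Lu + P.αu / 2

namespace Certificate

variable (c : Certificate D P K)

/-- The bounds of a certificate at time `t`. -/
structure Holds (t : ℕ) (σ : NetState N n m) : Prop where
  sync : σ.Synchronized
  est : ∀ j, c.VE (σ.x j - σ.xhat j) ≤ c.ME * P.γ ^ t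
  dis : c.V σ.x ≤ c.Mx * P.γ ^ t
  inp : ‖D.relInput K (relState N n σ.xhat) - σ.uhat‖ ≤ c.MH * P.γ ^ t

variable {c} {t : ℕ} {σ : NetState N n m}

theorem Holds.norm_est_le (h : c.Holds t σ) : ‖σ.x - σ.xhat‖ ≤ c.ME * P.γ ^ t := by
  have := P.γ_pos
  have := c.ME_nonneg
  exact (pi_norm_le_iff_of_nonneg (by positivity)).2 fun j => (c.norm_le_VE _).trans (h.est j)

theorem _root_.QuantizedNetwork.norm_relState_le (X : Fin N → Fin n → ℝ) :
    ‖relState N n X‖ ≤ 2 * ‖X‖ :=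
  (pi_norm_le_iff_of_nonneg (by positivity)).2 fun i =>
    (pi_norm_le_iff_of_nonneg (by positivity)).2 fun j => (norm_sub_le _ _).trans (by
      linarith [norm_le_pi_norm X i, norm_le_pi_norm X j])

theorem Holds.norm_innovation_lt (h : c.Holds t σ) (j : Fin N) :
    ‖innovation D P t σ j‖ < P.α * P.L + P.α / 2 := by
  have hγ : 0 < P.γ ^ t := pow_pos P.γ_pos t
  refine lt_of_le_of_lt ?_ c.lt_L
  rw [innovation, ← Matrix.mulVec_sub, norm_smul, norm_inv, Real.norm_of_nonneg hγ.le,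
    inv_mul_le_iff₀ hγ]
  calc _ ≤ c.cC * ‖σ.x j - σ.xhat j‖ := c.C_le _
    _ ≤ c.cC * (c.ME * P.γ ^ t) :=
      mul_le_mul_of_nonneg_left ((c.norm_le_VE _).trans (h.est j)) c.cC_nonneg
    _ = _ := by ring

theorem Holds.norm_innovationError_le (h : c.Holds t σ) (j : Fin N) :
    ‖innovationError D P t σ j‖ ≤ P.α / 2 :=
  norm_sub_quantizeVec_le P.α_pos _ (h.norm_innovation_lt j)

theorem Holds.est_step (h : c.Holds t σ) (j : Fin N) :
    c.VE ((step D P K t σ).x j - (step D P K t σ).xhat j) ≤ c.ME * P.γ ^ (t + 1) := by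
  have hγ : 0 < P.γ ^ t := pow_pos P.γ_pos t
  have h1 : c.VE (P.γ ^ t • (P.G *ᵥ innovationError D P t σ j)) ≤
      P.γ ^ t * (c.cE * (c.cG * (P.α / 2))) := by
    rw [map_smul_eq_mul, Real.norm_of_nonneg hγ.le]
    refine mul_le_mul_of_nonneg_left ((c.VE_le _).trans ?_) hγ.le
    refine mul_le_mul_of_nonneg_left ((c.G_le _).trans ?_) c.cE_nonneg
    exact mul_le_mul_of_nonneg_left (h.norm_innovationError_le j) c.cG_nonneg
  have h2 : c.VE (D.B *ᵥ (D.relInput K (relState N n σ.xhat) - σ.uhat) j) ≤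
      c.cE * (c.cB * (c.MH * P.γ ^ t)) := by
    refine (c.VE_le _).trans (mul_le_mul_of_nonneg_left ((c.B_le _).trans ?_) c.cE_nonneg)
    exact mul_le_mul_of_nonneg_left ((norm_le_pi_norm _ j).trans h.inp) c.cB_nonneg
  have h3 := (c.VE_contract (σ.x j - σ.xhat j)).trans
    (mul_le_mul_of_nonneg_left (h.est j) c.rE_nonneg)
  rw [estimationError_step t h.sync]
  refine (map_add_le_add c.VE _ _).trans ((add_le_add_left (map_add_le_add c.VE _ _) _).trans ?_)
  have h4 := mul_le_mul_of_nonneg_right c.le_ME hγ.le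
  rw [pow_succ]
  linarith

theorem Holds.dis_step (h : c.Holds t σ) : c.V (step D P K t σ).x ≤ c.Mx * P.γ ^ (t + 1) := by
  have hγ : 0 < P.γ ^ t := pow_pos P.γ_pos t
  have hME := c.ME_nonneg
  have hB := c.cB_nonneg
  have hR := c.cR_nonneg
  have h1 : ‖D.relInput K (relState N n (σ.x - σ.xhat))‖ ≤ c.cR * (2 * (c.ME * P.γ ^ t)) := by
    refine (c.R_le _).trans (mul_le_mul_of_nonneg_left ((norm_relState_le _).trans ?_) hR)
    exact mul_le_mul_of_nonneg_left h.norm_est_le zero_le_two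
  have h2 : ‖fun i => D.B *ᵥ D.relInput K (relState N n (σ.x - σ.xhat)) i‖ ≤
      c.cB * (c.cR * (2 * (c.ME * P.γ ^ t))) :=
    (pi_norm_le_iff_of_nonneg (by positivity)).2 fun i =>
      (c.B_le _).trans (mul_le_mul_of_nonneg_left ((norm_le_pi_norm _ i).trans h1) hB)
  have h3 := (c.V_contract σ.x).trans (mul_le_mul_of_nonneg_left h.dis c.r_nonneg)
  have h4 := (c.V_le _).trans (mul_le_mul_of_nonneg_left h2 c.cV_nonneg)
  rw [x_step t h.sync]
  refine (map_sub_le_add c.V _ _).trans ?_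
  have h5 := mul_le_mul_of_nonneg_right c.le_Mx hγ.le
  rw [pow_succ]
  linarith

/-- Only the bounds on `x` and on the estimation error enter, so this also applies at time t + 1
before the input error there is bounded. -/
theorem norm_relInput_le (hx : c.V σ.x ≤ c.Mx * P.γ ^ t)
    (hE : ∀ j, c.VE (σ.x j - σ.xhat j) ≤ c.ME * P.γ ^ t) :
    ‖D.relInput K (relState N n σ.xhat)‖ ≤ c.cR * (c.Mx + 2 * c.ME) * P.γ ^ t := by
  have hγ : 0 < P.γ ^ t := pow_pos P.γ_pos t
  have hME := c.ME_nonneg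
  have hMx := c.Mx_nonneg
  have hR := c.cR_nonneg
  rw [mul_assoc]
  refine (c.R_le _).trans (mul_le_mul_of_nonneg_left ?_ hR)
  refine (pi_norm_le_iff_of_nonneg (by positivity)).2 fun i =>
    (pi_norm_le_iff_of_nonneg (by positivity)).2 fun j => ?_
  have h1 : relState N n σ.xhat i j =
      σ.x j - σ.x i - ((σ.x j - σ.xhat j) - (σ.x i - σ.xhat i)) := by
    simp only [relState, LinearMap.coe_mk, AddHom.coe_mk]
    abel
  rw [h1]
  refine (norm_sub_le _ _).trans ((add_le_add_right (norm_sub_le _ _) _).trans ?_)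
  linarith [(c.norm_sub_le_V σ.x j i).trans hx, (c.norm_le_VE _).trans (hE i),
    (c.norm_le_VE _).trans (hE j)]

/-- The input splits as (u(t+1) - u(t)) + (u(t) - û(t)). There is no circularity: x̂(t+1) uses û(t),
not the control symbol being sent. -/
theorem Holds.norm_ctrlInnovation_lt (h : c.Holds t σ) (j : Fin N) :
    ‖ctrlInnovation D P K t σ j‖ < P.αu * P.Lu + P.αu / 2 := by
  have hγ : 0 < P.γ ^ t := pow_pos P.γ_pos t
  refine lt_of_le_of_lt ((norm_le_pi_norm _ j).trans ?_) c.lt_Lu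
  rw [ctrlInnovation_eq t h.sync, norm_smul, norm_inv, Real.norm_of_nonneg hγ.le,
    inv_mul_le_iff₀ hγ]
  refine (norm_add_le _ _).trans ((add_le_add_left (norm_sub_le _ _) _).trans ?_)
  have h1 := norm_relInput_le h.dis h.est
  have h2 := norm_relInput_le h.dis_step h.est_step
  have h0 : 0 ≤ c.cR * (c.Mx + 2 * c.ME) := by
    have := c.ME_nonneg; have := c.Mx_nonneg; have := c.cR_nonneg
    positivity
  have h3 : c.cR * (c.Mx + 2 * c.ME) * P.γ ^ (t + 1) ≤ c.cR * (c.Mx + 2 * c.ME) * P.γ ^ t :=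
    mul_le_mul_of_nonneg_left (pow_le_pow_of_le_one P.γ_pos.le P.γ_lt_one.le t.le_succ) h0
  linarith [h.inp]

theorem Holds.norm_ctrlError_le (h : c.Holds t σ) (j : Fin N) :
    ‖ctrlError D P K t σ j‖ ≤ P.αu / 2 :=
  norm_sub_quantizeVec_le P.αu_pos _ (h.norm_ctrlInnovation_lt j)

theorem Holds.step (h : c.Holds t σ) : c.Holds (t + 1) (step D P K t σ) where
  sync := h.sync.step t
  est := h.est_step
  dis := h.dis_step
  inp := by
    have hγ : 0 < P.γ ^ t := pow_pos P.γ_pos t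
    have hα := P.αu_pos
    rw [inputError_step t h.sync, norm_smul, Real.norm_of_nonneg hγ.le, pow_succ]
    have h1 : ‖ctrlError D P K t σ‖ ≤ P.αu / 2 :=
      (pi_norm_le_iff_of_nonneg (by positivity)).2 h.norm_ctrlError_le
    have h2 := mul_le_mul_of_nonneg_left (h1.trans c.le_MH) hγ.le
    linarith

theorem Holds.closedLoop {x0 xhat0 : Fin N → Fin n → ℝ} {uhat0 : Fin N → Fin m → ℝ}
    (h : c.Holds 0 (closedLoop D P K x0 xhat0 uhat0 0)) (t : ℕ) :
    c.Holds t (closedLoop D P K x0 xhat0 uhat0 t) := by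
  induction t with
  | zero => exact h
  | succ t ih => exact ih.step

variable (c) in
/-- The bounds hold at time `0` for sufficiently small initial values. -/
theorem holds_zero {x0 xhat0 : Fin N → Fin n → ℝ} {uhat0 : Fin N → Fin m → ℝ} {Cx Cxhat Cuhat : ℝ}
    (hx : ‖x0‖ < Cx) (hxhat : ‖xhat0‖ < Cxhat) (hu : ‖uhat0‖ < Cuhat)
    (h1 : c.cE * (Cx + Cxhat) ≤ c.ME) (h2 : c.cV * Cx ≤ c.Mx)
    (h3 : c.cR * (2 * Cxhat) + Cuhat ≤ c.MH) :
    c.Holds 0 (QuantizedNetwork.closedLoop D P K x0 xhat0 uhat0 0) where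
  sync := ⟨fun _ _ => rfl, fun _ _ => rfl⟩
  est j := by
    rw [pow_zero, mul_one]
    refine (c.VE_le _).trans (le_trans (mul_le_mul_of_nonneg_left ?_ c.cE_nonneg) h1)
    refine (norm_sub_le _ _).trans (add_le_add ?_ ?_)
    · exact (norm_le_pi_norm x0 j).trans hx.le
    · exact (norm_le_pi_norm xhat0 j).trans hxhat.le
  dis := by
    rw [pow_zero, mul_one]
    exact (c.V_le _).trans ((mul_le_mul_of_nonneg_left hx.le c.cV_nonneg).trans h2)
  inp := by
    rw [pow_zero, mul_one]
    refine (norm_sub_le _ _).trans (le_trans (add_le_add ?_ hu.le) h3)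
    refine (c.R_le _).trans (mul_le_mul_of_nonneg_left ((norm_relState_le _).trans ?_) c.cR_nonneg)
    exact mul_le_mul_of_nonneg_left hxhat.le zero_le_two

theorem tendsto_const_mul_pow (P : CommProtocol n p) (M : ℝ) :
    Tendsto (fun t : ℕ => M * P.γ ^ t) atTop (𝓝 0) := by
  simpa using (tendsto_pow_atTop_nhds_zero_of_lt_one P.γ_pos.le P.γ_lt_one).const_mul M

theorem achievesObservation {σ : ℕ → NetState N n m} (h : ∀ t, c.Holds t (σ t)) :
    AchievesObservation D σ := by
  have h1 (j) : Tendsto (fun t => (σ t).x j - (σ t).xhat j) atTop (𝓝 0) :=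
    squeeze_zero_norm (fun t => (c.norm_le_VE _).trans ((h t).est j)) (tendsto_const_mul_pow P c.ME)
  refine ⟨h1, fun i j _ => ?_⟩
  simpa only [(h _).sync.xdec_eq] using h1 j

theorem achievesStabilization {σ : ℕ → NetState N n m} (h : ∀ t, c.Holds t (σ t)) :
    AchievesStabilization D σ := by
  have h1 (i j) : Tendsto (fun t => (σ t).x i - (σ t).x j) atTop (𝓝 0) :=
    squeeze_zero_norm (fun t => (c.norm_sub_le_V _ i j).trans (h t).dis)
      (tendsto_const_mul_pow P c.Mx)
  refine ⟨h1, fun w hw hw0 _ => ?_⟩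
  have hs : ∑ j, w j ≠ 0 := fun hs => hw0 <| funext fun j =>
    (Finset.sum_eq_zero_iff_of_nonneg fun j _ => hw j).1 hs j (Finset.mem_univ j)
  rw [tendsto_pi_nhds]
  intro i
  -- δ_i is a weighted mean of the differences x_i - x_j.
  have h2 (t) : stabilizationError w (σ t) i =
      (∑ j, w j)⁻¹ • ∑ j, w j • ((σ t).x i - (σ t).x j) := by
    simp only [smul_sub, Finset.sum_sub_distrib, ← Finset.sum_smul]
    rw [smul_smul, inv_mul_cancel₀ hs, one_smul]
    rfl
  simp only [h2]
  have h3 := (tendsto_finsetSum Finset.univ fun j _ => (h1 i j).const_smul (w j)).const_smul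
    (∑ j, w j)⁻¹
  simpa using h3

end Certificate
end ClosedLoop

end QuantizedNetwork

/-! ### Choice of the parameters -/

/-- The norms on `Fin k → ℝ` and `Fin N → Fin k → ℝ` are the maximum norms. -/
theorem theorem1 {N n m p : ℕ} (D : DynamicNetwork N n m p)
    (hA1 : D.SimultaneouslyStabilizable) (hA2 : D.Detectable) :
    ∃ W > (0 : ℝ), ∃ Wu > (0 : ℝ),
      ∀ Cx > (0 : ℝ), ∀ Cxhat > (0 : ℝ), ∀ Cuhat > (0 : ℝ),
        ∃ (P : CommProtocol n p) (K : Matrix (Fin m) (Fin n) ℝ),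
          ∀ (x0 xhat0 : Fin N → Fin n → ℝ) (uhat0 : Fin N → Fin m → ℝ),
            ‖x0‖ < Cx → ‖xhat0‖ < Cxhat → ‖uhat0‖ < Cuhat →
            let σ := closedLoop D P K x0 xhat0 uhat0
            AchievesObservation D σ ∧ AchievesStabilization D σ ∧
            (∀ t j, ‖innovationError D P t (σ t) j‖ ≤ W) ∧
            (∀ t j, ‖ctrlError D P K t (σ t) j‖ ≤ Wu) ∧
            (∀ t j, ‖innovation D P t (σ t) j‖ < P.α * P.L + P.α / 2) ∧
            (∀ t j, ‖ctrlInnovation D P K t (σ t) j‖ < P.αu * P.Lu + P.αu / 2) := by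
  obtain ⟨K, hK⟩ := hA1
  obtain ⟨G, hG⟩ := hA2
  obtain ⟨rE, hrE0, hrE1, VE, hVE1, ⟨cE, hcE0, hcE⟩, hVE2⟩ :=
    (D.A - G * D.C).exists_seminorm_mulVec_le hG
  obtain ⟨r, hr0, hr1, V, hV1, ⟨cV, hcV0, hcV⟩, hV2⟩ := D.exists_seminorm_idealStep_le K hK
  obtain ⟨cB, hcB0, hcB⟩ := (Matrix.toLin' D.B).exists_norm_le_mul
  obtain ⟨cC, hcC0, hcC⟩ := (Matrix.toLin' D.C).exists_norm_le_mul
  obtain ⟨cG, hcG0, hcG⟩ := (Matrix.toLin' G).exists_norm_le_mul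
  obtain ⟨cR, hcR0, hcR⟩ := (D.relInput K).exists_norm_le_mul
  -- The scaling must decay more slowly than both contractions, so that γ - rE and γ - r are
  -- positive divisors.
  obtain ⟨γ, hγ, hγ1⟩ := exists_between (max_lt hrE1 hr1)
  obtain ⟨hγE, hγr⟩ := max_lt_iff.1 hγ
  have hγ0 : 0 < γ := hr0.trans hγr
  refine ⟨1 / 2, by norm_num, 1 / 2, by norm_num, fun Cx hCx Cxhat hCxhat Cuhat hCuhat => ?_⟩
  -- In each maximum the first entry propagates the bound and the second covers the initial values.
  -- The division by γ arises because an error of size γ^t must fit under `MH` γ^(t+1).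
  let MH := max (1 / 2 / γ) (cR * (2 * Cxhat) + Cuhat)
  have hMH0 : 0 ≤ MH := le_max_of_le_left (by positivity)
  let ME := max (cE * (cG * (1 / 2) + cB * MH) / (γ - rE)) (cE * (Cx + Cxhat))
  have hME0 : 0 ≤ ME := le_max_of_le_right (by positivity)
  let Mx := max (cV * (cB * (cR * (2 * ME))) / (γ - r)) (cV * Cx)
  have hMx0 : 0 ≤ Mx := le_max_of_le_right (by positivity)
  obtain ⟨L, hL⟩ := exists_nat_gt (cC * ME)
  obtain ⟨Lu, hLu⟩ := exists_nat_gt (2 * (cR * (Mx + 2 * ME)) + MH)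
  let P : CommProtocol n p :=
    { γ := γ, α := 1, αu := 1, L := L + 1, Lu := Lu + 1, G := G, γ_pos := hγ0, γ_lt_one := hγ1
      α_pos := one_pos, α_le_one := le_rfl, αu_pos := one_pos, αu_le_one := le_rfl
      one_le_L := by omega, one_le_Lu := by omega }
  let c : Certificate D P K :=
    { VE := VE, V := V, rE := rE, r := r, cE := cE, cV := cV, cB := cB, cC := cC, cG := cG
      cR := cR, ME := ME, Mx := Mx, MH := MH
      rE_nonneg := hrE0.le, r_nonneg := hr0.le, cE_nonneg := hcE0, cV_nonneg := hcV0
      cB_nonneg := hcB0, cC_nonneg := hcC0, cG_nonneg := hcG0, cR_nonneg := hcR0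
      ME_nonneg := hME0, Mx_nonneg := hMx0
      norm_le_VE := hVE1, VE_le := hcE, VE_contract := hVE2
      norm_sub_le_V := hV1, V_le := hcV, V_contract := hV2
      B_le := hcB, C_le := hcC, G_le := hcG, R_le := hcR
      le_ME := by
        have := (div_le_iff₀ (sub_pos.2 hγE)).1 (le_max_left _ _ : _ ≤ ME)
        change rE * ME + cE * (cG * (1 / 2) + cB * MH) ≤ ME * γ
        linarith
      le_Mx := by
        have := (div_le_iff₀ (sub_pos.2 hγr)).1 (le_max_left _ _ : _ ≤ Mx)
        change r * Mx + cV * (cB * (cR * (2 * ME))) ≤ Mx * γ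
        linarith
      le_MH := (div_le_iff₀ hγ0).1 (le_max_left _ _)
      lt_L := by
        change cC * ME < 1 * ((L + 1 : ℕ) : ℝ) + 1 / 2
        push_cast
        linarith
      lt_Lu := by
        change 2 * (cR * (Mx + 2 * ME)) + MH < 1 * ((Lu + 1 : ℕ) : ℝ) + 1 / 2
        push_cast
        linarith }
  refine ⟨P, K, fun x0 xhat0 uhat0 hx hxhat hu => ?_⟩
  have h := (c.holds_zero hx hxhat hu (le_max_right _ _) (le_max_right _ _)
    (le_max_right _ _)).closedLoop
  exact ⟨Certificate.achievesObservation h, Certificate.achievesStabilization h,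
    fun t => (h t).norm_innovationError_le, fun t => (h t).norm_ctrlError_le,
    fun t => (h t).norm_innovation_lt, fun t => (h t).norm_ctrlInnovation_lt⟩
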